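/- For a finite simple graph $G$ with no isolated vertices, let $t(G)$ be the least $k$ such that the vertex set $V(G)$ is a union of $k$ (not necessarily disjoint) sets, each of which spans an induced subgraph of $G$ with all degrees odd. For $n \ge 2$ let $$t(n)=\max\{t(G) : G \text{ is a graph on } n \text{ vertices with no isolated vertices}\};$$ equivalently, $t(n)$ is the least $k$ such that the vertex set of every $n$-vertex graph with no isolated vertices can be covered by $k$ sets, each inducing a subgraph with all degrees odd. Then $t(n)=\Theta(\log n)$ as $n\to\infty$: there exist constants $c, C>0$ and $n_0$ such that $c\log n\le t(n)\le C\log n$ for all integers $n\ge n_0$. -/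

import Mathlib

open Filter Asymptotics

namespace OddCover

/-- The vertex set `S` spans an induced subgraph of `G` in which every degree is odd. -/
def SpansOdd {V : Type*} [Fintype V] (G : SimpleGraph V) (S : Set V) : Prop :=
  open Classical in ∀ v : S, Odd ((G.induce S).degree v)

/-- The vertex set of `G` is the union of `k` sets (not necessarily disjoint or distinct),
each of which spans an induced subgraph with all degrees odd. -/
def HasOddCover {V : Type*} [Fintype V] (G : SimpleGraph V) (k : ℕ) : Prop :=
  ∃ S : Fin k → Set V, (∀ i, SpansOdd G (S i)) ∧ ⋃ i, S i = Set.univ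

/-- `t(G)`: the least number of sets in an odd cover of `G`. The minimum is over a nonempty set
whenever `G` has no isolated vertices, see `hasOddCover_coverNumber`. -/
noncomputable def coverNumber {V : Type*} [Fintype V] (G : SimpleGraph V) : ℕ :=
  sInf {k : ℕ | HasOddCover G k}

/-- `t(n)`: the largest value of `t(G)` over all graphs `G` on `n` vertices that have no isolated
vertices. See `maxCoverNumber_le_iff`. -/
noncomputable def maxCoverNumber (n : ℕ) : ℕ :=
  sSup {k : ℕ | ∃ G : SimpleGraph (Fin n), (∀ v, ¬ G.IsIsolated v) ∧ coverNumber G = k}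

theorem spansOdd_pair {V : Type*} [Fintype V] {G : SimpleGraph V} {u w : V} (h : G.Adj u w) :
    SpansOdd G {u, w} := by
  classical
  rintro ⟨v, hv⟩
  have key : ∃! x : ({u, w} : Set V), (G.induce {u, w}).Adj ⟨v, hv⟩ x := by
    rcases hv with rfl | rfl
    · refine ⟨⟨w, by simp⟩, by simpa using h, ?_⟩
      rintro ⟨y, rfl | rfl⟩ hy
      · simp at hy
      · rfl
    · refine ⟨⟨u, by simp⟩, by simpa using h.symm, ?_⟩
      rintro ⟨y, rfl | rfl⟩ hy
      · rfl
      · simp at hy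
  rw [← SimpleGraph.degree_eq_one_iff_existsUnique_adj] at key
  convert odd_one
  convert key

/-- A graph without isolated vertices has an odd cover: take all its edges. -/
theorem exists_hasOddCover {V : Type*} [Fintype V] (G : SimpleGraph V)
    (hG : ∀ v, ¬ G.IsIsolated v) : ∃ k, HasOddCover G k := by
  have h : ∀ v, ∃ w, G.Adj v w := by
    intro v
    by_contra! hv
    exact hG v (fun w => hv w)
  choose f hf using h
  let e := Fintype.equivFin V
  refine ⟨Fintype.card V, fun i => {e.symm i, f (e.symm i)}, fun i => spansOdd_pair (hf _), ?_⟩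
  refine Set.eq_univ_of_forall fun v => Set.mem_iUnion.2 ⟨e v, ?_⟩
  simp

theorem HasOddCover.mono {V : Type*} [Fintype V] {G : SimpleGraph V} {k l : ℕ}
    (h : HasOddCover G k) (hkl : k ≤ l) : HasOddCover G l := by
  obtain ⟨S, hS, hc⟩ := h
  refine ⟨fun i => if hi : i.1 < k then S ⟨i, hi⟩ else ∅, fun i => ?_, ?_⟩
  · dsimp only
    split_ifs with hi
    · exact hS _
    · rintro ⟨v, hv⟩
      exact hv.elim
  · refine Set.eq_univ_of_forall fun v => ?_
    obtain ⟨i, hi⟩ := Set.mem_iUnion.1 (hc ▸ Set.mem_univ v : v ∈ ⋃ i, S i)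
    exact Set.mem_iUnion.2 ⟨⟨i, i.2.trans_le hkl⟩, by simpa using hi⟩

theorem hasOddCover_coverNumber {V : Type*} [Fintype V] (G : SimpleGraph V)
    (hG : ∀ v, ¬ G.IsIsolated v) : HasOddCover G (coverNumber G) :=
  Nat.sInf_mem (s := {k : ℕ | HasOddCover G k}) (exists_hasOddCover G hG)

/-- `t(n)` is the least `k` such that every `n`-vertex graph without isolated vertices has an odd
cover by `k` sets. -/
theorem maxCoverNumber_le_iff (n k : ℕ) :
    maxCoverNumber n ≤ k ↔
      ∀ G : SimpleGraph (Fin n), (∀ v, ¬ G.IsIsolated v) → HasOddCover G k := by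
  have hfin : {k : ℕ | ∃ G : SimpleGraph (Fin n),
      (∀ v, ¬ G.IsIsolated v) ∧ coverNumber G = k}.Finite :=
    (Set.finite_range (fun G : SimpleGraph (Fin n) => coverNumber G)).subset
      (fun _ ⟨G, _, hk⟩ => ⟨G, hk⟩)
  constructor
  · intro h G hG
    exact (hasOddCover_coverNumber G hG).mono ((le_csSup hfin.bddAbove ⟨G, hG, rfl⟩).trans h)
  · intro h
    refine csSup_le' ?_
    rintro _ ⟨G, hG, rfl⟩
    exact Nat.sInf_le (h G hG)

end OddCover

namespace OddCover

open Finset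

/-! Upper bound: every vertex set U has at least an eighth of its vertices in one odd set
(`exists_spansOdd_inter`), so greedy removal exhausts V in O(log n) rounds. Fix a maximal
independent set I. If half of U lies outside I, some R ⊆ I is seen an odd number of times by half of
those vertices, and a Gallai-type partition over F₂ (`exists_large_even`) yields half of these in
one odd set, completed by vertices of R. If half of U lies in I, a minimal dominating set of that
half supplies private neighbours that repair parities.

Lower bound: give each pair among m hubs a vertex adjacent exactly to those two. An odd set
containing that vertex contains exactly one of the two hubs, so hubs have distinct membership
patterns and m ≤ 2^k, with m about √n. -/

/-! ### Linear algebra over F₂ and Gallai's theorem -/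

/-- Otherwise some functional y kills the column space but not the diagonal. Yet yᵀMy = Σ Mᵢᵢyᵢ over
F₂, since off-diagonal terms cancel in pairs and yᵢ² = yᵢ. -/
lemma exists_mulVec_eq_diag {V : Type*} [Fintype V] [DecidableEq V] (M : Matrix V V (ZMod 2))
    (hM : M.IsSymm) : ∃ x : V → ZMod 2, M.mulVec x = M.diag := by
  by_contra! h
  have hd : M.diag ∉ LinearMap.range M.mulVecLin := by
    rintro ⟨x, hx⟩
    exact h x hx
  obtain ⟨f, hf, hle⟩ := Submodule.exists_le_ker_of_notMem hd
  set y : V → ZMod 2 := fun i => f (Pi.single i 1) with hy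
  have hfy : ∀ x, f x = ∑ i, x i * y i := by
    intro x
    rw [LinearMap.pi_apply_eq_sum_univ f x]
    simp only [smul_eq_mul, hy]
    refine sum_congr rfl fun i _ => ?_
    congr 2
    ext j
    simp [Pi.single_apply, eq_comm]
  have h0 : f (M.mulVec y) = 0 := hle ⟨y, rfl⟩
  apply hf
  rw [hfy] at h0 ⊢
  rw [← h0]
  simp only [Matrix.mulVec, dotProduct, sum_mul, Matrix.diag_apply]
  rw [← sum_product' (s := univ) (t := univ) (f := fun i j => M i j * y j * y i),
    ← sum_filter_add_sum_filter_not _ (fun p : V × V => p.1 = p.2)]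
  have hoff : ∑ p ∈ (univ ×ˢ univ : Finset (V × V)).filter (fun p => ¬ p.1 = p.2),
      M p.1 p.2 * y p.2 * y p.1 = 0 := by
    refine sum_involution (fun p _ => p.swap) ?_ ?_ ?_ ?_
    · rintro ⟨i, j⟩ -
      simp only [Prod.fst_swap, Prod.snd_swap, hM.apply i j]
      rw [mul_right_comm]
      exact CharTwo.add_self_eq_zero _
    · rintro ⟨i, j⟩ hp - hs
      simp only [mem_filter, Prod.swap, Prod.mk.injEq] at hp hs
      exact hp.2 hs.2
    · rintro ⟨i, j⟩ hp
      simpa [eq_comm] using hp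
    · rintro ⟨i, j⟩ -
      rfl
  rw [hoff, add_zero]
  refine sum_bij (fun i _ => (i, i)) (by simp) (by simp) ?_ ?_
  · rintro ⟨i, j⟩ hp
    simp only [mem_filter] at hp
    exact ⟨i, mem_univ _, by simp [hp.2]⟩
  · intro i _
    have : y i * y i = y i := by generalize y i = a; revert a; decide
    rw [mul_assoc, this]

/-- A form of Gallai's theorem on partitions into two parts inducing even degrees. -/
lemma exists_large_even {V : Type*} [Fintype V] [DecidableEq V] (B : V → V → ZMod 2)
    (hB : ∀ u w, B u w = B w u) (T : Finset V) :
    ∃ P ⊆ T, #T ≤ 2 * #P ∧ ∀ u ∈ P, ∑ w ∈ P, B u w = B u u := by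
  -- On T the diagonal of L is the row sum of B with the term z = u cancelled. A solution x of Lx =
  -- diag L splits T into two classes, both with the required row sums.
  let L : Matrix V V (ZMod 2) := fun u w =>
    if u ∈ T ∧ w ∈ T then (if u = w then ∑ z ∈ T, B u z + B u u else B u w) else 0
  obtain ⟨x, hx⟩ := exists_mulVec_eq_diag L (by
    ext u w
    rw [Matrix.transpose_apply]
    by_cases h : u = w
    · subst h; rfl
    · simp only [L, and_comm, h, Ne.symm h, hB u w, if_false])
  have key : ∀ u ∈ T, ∑ w ∈ T, B u w * x w + (∑ z ∈ T, B u z) * x u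
      = ∑ z ∈ T, B u z + B u u := by
    intro u hu
    have := congrFun hx u
    rw [Matrix.diag_apply] at this
    simp only [Matrix.mulVec, dotProduct, L, hu, true_and, if_true] at this
    rw [← this]
    have h2 : ∀ w, (if w ∈ T then (if u = w then ∑ z ∈ T, B u z + B u u else B u w) else 0) * x w
        = (if w ∈ T then B u w * x w else 0) + (if w = u then (∑ z ∈ T, B u z) * x u else 0) := by
      intro w
      by_cases h : w = u
      · subst h
        simp only [hu, if_true]
        ring
      · simp [h, Ne.symm h]
    simp only [h2, sum_add_distrib, sum_ite_mem, univ_inter, sum_ite_eq', mem_univ, if_true]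
  have h01 : ∀ a : ZMod 2, a = 0 ∨ a = 1 := by decide
  have hP : ∀ c : ZMod 2, ∀ u ∈ T.filter (fun u => x u = c),
      ∑ w ∈ T.filter (fun u => x u = c), B u w = B u u := by
    intro c u hu
    rw [mem_filter] at hu
    have hk := key u hu.1
    rw [hu.2] at hk
    have h3 : ∑ w ∈ T.filter (fun u => x u = c), B u w = ∑ w ∈ T, B u w * (x w + c + 1) := by
      rw [sum_filter]
      refine sum_congr rfl fun w _ => ?_
      have : ∀ a b d : ZMod 2, (if a = d then b else 0) = b * (a + d + 1) := by decide
      exact this _ _ _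
    have h4 : ∑ w ∈ T, B u w * (x w + c + 1)
        = ∑ w ∈ T, B u w * x w + (∑ w ∈ T, B u w) * c + ∑ w ∈ T, B u w := by
      simp only [mul_add, sum_add_distrib, sum_mul, mul_one]
    rw [h3, h4, hk, add_right_comm, CharTwo.add_self_eq_zero, zero_add]
  have hcard : #T = #(T.filter fun u => x u = 0) + #(T.filter fun u => x u = 1) := by
    rw [← card_filter_add_card_filter_not (s := T) (fun u => x u = 0)]
    congr 2
    refine filter_congr fun u _ => ?_
    rcases h01 (x u) with h | h <;> simp [h]
  rcases le_total #(T.filter fun u => x u = 0) #(T.filter fun u => x u = 1) with h | h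
  · exact ⟨_, filter_subset _ _, by omega, hP 1⟩
  · exact ⟨_, filter_subset _ _, by omega, hP 0⟩

/-- The entries of the adjacency matrix modulo 2. -/
noncomputable def adj {V : Type*} (G : SimpleGraph V) (u w : V) : ZMod 2 :=
  open Classical in if G.Adj u w then 1 else 0

/-! ### Parities of neighbourhoods -/

section

variable {V : Type*} (G : SimpleGraph V)

lemma adj_comm (u w : V) : adj G u w = adj G w u := by
  classical exact if_congr (G.adj_comm u w) rfl rfl

@[simp] lemma adj_self (u : V) : adj G u u = 0 := by
  simp [adj]

variable {G}

lemma adj_eq_one {u w : V} (h : G.Adj u w) : adj G u w = 1 := by simp [adj, h]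

lemma adj_eq_zero {u w : V} (h : ¬ G.Adj u w) : adj G u w = 0 := by simp [adj, h]

/-- A derandomised random choice of R: adding x flips the parity at exactly the neighbours of x, so
either R or `insert x R` serves half of them. -/
lemma exists_half_odd [DecidableEq V] (X T : Finset V) (hT : ∀ t ∈ T, ∃ x ∈ X, G.Adj t x) :
    ∃ R ⊆ X, #T ≤ 2 * #(T.filter fun t => ∑ r ∈ R, adj G t r = 1) := by
  classical
  induction X using Finset.induction_on generalizing T with
  | empty =>
    refine ⟨∅, subset_rfl, ?_⟩
    rw [eq_empty_of_forall_notMem (s := T) fun t ht => by simpa using hT t ht]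
    simp
  | insert x X hx ih =>
    obtain ⟨R, hRX, hR⟩ := ih (T.filter fun t => ¬ G.Adj t x) (by
      intro t ht
      rw [mem_filter] at ht
      obtain ⟨y, hy, hty⟩ := hT t ht.1
      rcases mem_insert.1 hy with rfl | hy
      · exact absurd hty ht.2
      · exact ⟨y, hy, hty⟩)
    have hxR : x ∉ R := fun h => hx (hRX h)
    have hsplit : ∀ R' : Finset V, #(T.filter fun t => ∑ r ∈ R', adj G t r = 1) =
        #((T.filter fun t => G.Adj t x).filter fun t => ∑ r ∈ R', adj G t r = 1) +
        #((T.filter fun t => ¬ G.Adj t x).filter fun t => ∑ r ∈ R', adj G t r = 1) := by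
      intro R'
      rw [← card_filter_add_card_filter_not (s := T.filter _) (fun t => G.Adj t x)]
      simp only [filter_filter, and_comm]
    have hT2 := card_filter_add_card_filter_not (s := T) (fun t => G.Adj t x)
    have h1 : ((T.filter fun t => ¬ G.Adj t x).filter fun t => ∑ r ∈ insert x R, adj G t r = 1) =
        (T.filter fun t => ¬ G.Adj t x).filter fun t => ∑ r ∈ R, adj G t r = 1 := by
      refine filter_congr fun t ht => ?_
      rw [mem_filter] at ht
      rw [sum_insert hxR, adj_eq_zero ht.2, zero_add]
    have h2 : ((T.filter fun t => G.Adj t x).filter fun t => ∑ r ∈ insert x R, adj G t r = 1) =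
        (T.filter fun t => G.Adj t x).filter fun t => ¬ ∑ r ∈ R, adj G t r = 1 := by
      refine filter_congr fun t ht => ?_
      rw [mem_filter] at ht
      rw [sum_insert hxR, adj_eq_one ht.2]
      generalize ∑ r ∈ R, adj G t r = a
      revert a; decide
    have h3 := card_filter_add_card_filter_not (s := T.filter fun t => G.Adj t x)
      (fun t => ∑ r ∈ R, adj G t r = 1)
    have hs := hsplit (insert x R)
    have hs' := hsplit R
    rw [h1, h2] at hs
    by_cases h : #(T.filter fun t => G.Adj t x) ≤
        2 * #((T.filter fun t => G.Adj t x).filter fun t => ∑ r ∈ R, adj G t r = 1)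
    · exact ⟨R, hRX.trans (subset_insert _ _), by omega⟩
    · exact ⟨insert x R, insert_subset_insert _ hRX, by omega⟩

variable [Fintype V]

lemma spansOdd_iff {S : Finset V} :
    SpansOdd G (S : Set V) ↔ ∀ v ∈ S, ∑ w ∈ S, adj G v w = 1 := by
  classical
  have hdeg : ∀ v : (S : Set V), (G.induce (S : Set V)).degree v =
      #{w : (S : Set V) | (G.induce (S : Set V)).Adj v w} := by
    intro v
    rw [← SimpleGraph.neighborFinset_eq_filter, SimpleGraph.card_neighborFinset_eq_degree]
  have key : ∀ v (hv : v ∈ (S : Set V)),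
      Odd (#{w : (S : Set V) | (G.induce (S : Set V)).Adj ⟨v, hv⟩ w}) ↔
        ∑ w ∈ S, adj G v w = 1 := by
    intro v hv
    have h1 : ∑ w ∈ S, adj G v w = (#(S.filter fun w => G.Adj v w) : ZMod 2) := by
      simp only [adj, sum_boole]
    have h2 : #{w : (S : Set V) | (G.induce (S : Set V)).Adj ⟨v, hv⟩ w}
        = #(S.filter fun w => G.Adj v w) := by
      refine card_bij (fun w _ => w.1) ?_ ?_ ?_
      · rintro ⟨w, hw⟩ h
        simp at h hw
        simp [h, hw]
      · intro a _ b _ h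
        exact Subtype.ext h
      · intro w hw
        rw [mem_filter] at hw
        exact ⟨⟨w, hw.1⟩, by simpa using hw.2, rfl⟩
    rw [h1, h2, ZMod.natCast_eq_one_iff_odd]
  unfold SpansOdd
  constructor
  · intro h v hv
    rw [← key v hv, ← hdeg]
    convert h ⟨v, hv⟩
  · rintro h ⟨v, hv⟩
    have := (key v hv).2 (h v hv)
    rw [← hdeg] at this
    convert this

/-! ### Odd sets capturing a fixed fraction -/

/-- Apply the partition to adjacency plus the number of common neighbours in R. If Q is the set of r
∈ R with oddly many neighbours in P, the row sum over P at v ∈ P is the degree of v in P ∪ Q, and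
the diagonal entry is 1. Vertices of Q are odd because R is independent. -/
lemma exists_spansOdd_of_indep [DecidableEq V] {R T : Finset V}
    (hR : ∀ r ∈ R, ∀ s ∈ R, ¬ G.Adj r s) (hRT : Disjoint R T)
    (hT : ∀ t ∈ T, ∑ r ∈ R, adj G t r = 1) :
    ∃ S : Finset V, SpansOdd G (S : Set V) ∧ #T ≤ 2 * #(S ∩ T) := by
  obtain ⟨P, hPT, hcard, hP⟩ := exists_large_even
    (fun u w => adj G u w + ∑ r ∈ R, adj G u r * adj G r w) (by
      intro u w
      rw [adj_comm]
      congr 1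
      refine sum_congr rfl fun r _ => ?_
      rw [adj_comm G u r, adj_comm G r w, mul_comm]) T
  set Q := R.filter fun r => ∑ w ∈ P, adj G r w = 1 with hQ
  have hdis : Disjoint P Q :=
    (disjoint_of_subset_left (filter_subset _ _) (disjoint_of_subset_right hPT hRT)).symm
  refine ⟨P ∪ Q, spansOdd_iff.2 fun v hv => ?_, hcard.trans ?_⟩
  · rw [sum_union hdis]
    rcases mem_union.1 hv with hv | hv
    · have h1 := hP v hv
      simp only [adj_self, zero_add, sum_add_distrib] at h1
      have h2 : ∑ r ∈ R, adj G v r * adj G r v = 1 := by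
        rw [← hT v (hPT hv)]
        refine sum_congr rfl fun r _ => ?_
        rw [adj_comm G r v]
        generalize adj G v r = a
        revert a; decide
      rw [h2] at h1
      rw [← h1, sum_comm]
      congr 1
      rw [hQ, sum_filter]
      refine sum_congr rfl fun r _ => ?_
      rw [← mul_sum]
      generalize adj G v r = a
      generalize ∑ w ∈ P, adj G r w = b
      revert a b; decide
    · rw [hQ, mem_filter] at hv
      rw [hv.2, sum_eq_zero, add_zero]
      intro w hw
      exact adj_eq_zero (hR _ hv.1 _ (mem_of_mem_filter _ hw))
  · gcongr
    exact subset_inter subset_union_left hPT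

/-- Private neighbours repair the parities of the vertices of `R`. -/
lemma exists_spansOdd_of_private [DecidableEq V] {R Q : Finset V} {p : V → V}
    (hp : ∀ x ∈ R, ∀ y ∈ R, G.Adj (p x) y ↔ x = y)
    (hpp : ∀ x ∈ R, ∀ y ∈ R, ¬ G.Adj (p x) (p y))
    (hQ : ∀ q ∈ Q, ∀ q' ∈ Q, ¬ G.Adj q q') (hpQ : ∀ x ∈ R, ∀ q ∈ Q, ¬ G.Adj (p x) q)
    (hRQ : Disjoint R Q) (hpR : ∀ x ∈ R, p x ∉ R ∪ Q)
    (hodd : ∀ q ∈ Q, ∑ r ∈ R, adj G q r = 1) :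
    SpansOdd G ((R ∪ Q ∪ (R.filter fun x => ∑ w ∈ R ∪ Q, adj G x w = 0).image p : Finset V) :
      Set V) := by
  -- Each x of even degree in R ∪ Q gains p x, which touches no other vertex of R and none of Q.
  set F := R.filter fun x => ∑ w ∈ R ∪ Q, adj G x w = 0 with hF
  have hFR : F ⊆ R := filter_subset _ _
  have hinj : Set.InjOn p F := by
    intro x hx y hy h
    have := (hp y (hFR hy) y (hFR hy)).2 rfl
    rw [← h, hp x (hFR hx) y (hFR hy)] at this
    exact this
  have hdis : Disjoint (R ∪ Q) (F.image p) := by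
    rw [disjoint_right]
    intro w hw
    obtain ⟨x, hx, rfl⟩ := mem_image.1 hw
    exact hpR x (hFR hx)
  refine spansOdd_iff.2 fun v hv => ?_
  rw [sum_union hdis, sum_image hinj]
  rcases mem_union.1 hv with hv | hv
  · rcases mem_union.1 hv with hv | hv
    · have h1 : ∑ x ∈ F, adj G v (p x) = ∑ x ∈ F, if x = v then (1 : ZMod 2) else 0 := by
        refine sum_congr rfl fun x hx => ?_
        rw [adj_comm]
        split_ifs with h
        · exact adj_eq_one ((hp x (hFR hx) v hv).2 h)
        · exact adj_eq_zero (mt (hp x (hFR hx) v hv).1 h)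
      rw [h1, sum_ite_eq', hF]
      simp only [mem_filter, hv, true_and]
      generalize ∑ w ∈ R ∪ Q, adj G v w = a
      revert a; decide
    · rw [sum_union hRQ, hodd v hv, sum_eq_zero (s := Q), sum_eq_zero (s := F)]
      · simp
      · intro x hx
        rw [adj_comm]
        exact adj_eq_zero (hpQ x (hFR hx) v hv)
      · exact fun w hw => adj_eq_zero (hQ v hv w hw)
  · obtain ⟨x, hx, rfl⟩ := mem_image.1 hv
    rw [sum_union hRQ, sum_eq_zero (s := Q), sum_eq_zero (s := F), add_zero, add_zero,
      sum_eq_single x, adj_eq_one ((hp x (hFR hx) x (hFR hx)).2 rfl)]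
    · intro y hy hyx
      exact adj_eq_zero (mt (hp x (hFR hx) y hy).1 hyx.symm)
    · exact fun h => absurd (hFR hx) h
    · exact fun y hy => adj_eq_zero (hpp x (hFR hx) y (hFR hy))
    · exact fun q hq => adj_eq_zero (hpQ x (hFR hx) q hq)

lemma exists_spansOdd_inter_indep [DecidableEq V] {T : Finset V}
    (hT : ∀ t ∈ T, ∀ s ∈ T, ¬ G.Adj t s) (hG : ∀ t ∈ T, ∃ x, G.Adj t x) :
    ∃ S : Finset V, SpansOdd G (S : Set V) ∧ #T ≤ 4 * #(S ∩ T) := by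
  classical
  obtain ⟨X, hXmin⟩ := exists_minimal_of_wellFoundedLT
    (fun X : Finset V => ∀ t ∈ T, ∃ x ∈ X, G.Adj t x)
    ⟨univ, fun t ht => (hG t ht).imp fun x hx => ⟨mem_univ _, hx⟩⟩
  have hX := hXmin.prop
  have hpriv : ∀ x, ∃ t, x ∈ X → t ∈ T ∧ ∀ y ∈ X, G.Adj t y ↔ x = y := by
    intro x
    by_cases hx : x ∈ X
    · have hnot := hXmin.not_prop_of_lt (erase_ssubset hx)
      push Not at hnot
      obtain ⟨t, ht, htx⟩ := hnot
      refine ⟨t, fun _ => ⟨ht, fun y hy => ⟨fun hty => ?_, ?_⟩⟩⟩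
      · by_contra hne
        exact htx y (mem_erase.2 ⟨Ne.symm hne, hy⟩) hty
      · rintro rfl
        obtain ⟨z, hz, htz⟩ := hX t ht
        by_cases hzx : z = x
        · exact hzx ▸ htz
        · exact absurd htz (htx z (mem_erase.2 ⟨hzx, hz⟩))
    · exact ⟨x, fun h => absurd h hx⟩
  choose p hp using hpriv
  have hXT : ∀ x ∈ X, x ∉ T := fun x hx hxT =>
    hT _ (hp x hx).1 x hxT (((hp x hx).2 x hx).2 rfl)
  have main : ∀ R ⊆ X, ∀ Q ⊆ T \ X.image p, (∀ q ∈ Q, ∑ r ∈ R, adj G q r = 1) →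
      SpansOdd G ((R ∪ Q ∪ (R.filter fun x => ∑ w ∈ R ∪ Q, adj G x w = 0).image p : Finset V) :
        Set V) := by
    intro R hR Q hQ hodd
    have hQT : Q ⊆ T := hQ.trans sdiff_subset
    refine exists_spansOdd_of_private
      (fun x hx y hy => (hp x (hR hx)).2 y (hR hy))
      (fun x hx y hy => hT _ (hp x (hR hx)).1 _ (hp y (hR hy)).1)
      (fun q hq q' hq' => hT _ (hQT hq) _ (hQT hq'))
      (fun x hx q hq => hT _ (hp x (hR hx)).1 _ (hQT hq)) ?_ ?_ hodd
    · exact disjoint_left.2 fun x hx hxQ => hXT x (hR hx) (hQT hxQ)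
    · intro x hx h
      rcases mem_union.1 h with h | h
      · exact hXT _ (hR h) (hp x (hR hx)).1
      · exact (mem_sdiff.1 (hQ h)).2 (mem_image_of_mem _ (hR hx))
  have hinj : Set.InjOn p X := by
    intro x hx y hy h
    have := ((hp y hy).2 y hy).2 rfl
    rw [← h, (hp x hx).2 y hy] at this
    exact this
  have himg : X.image p ⊆ T := by
    intro t ht
    obtain ⟨x, hx, rfl⟩ := mem_image.1 ht
    exact (hp x hx).1
  -- If X is small, at least half of T is not a chosen private neighbour, and half of that goes into
  -- Q.
  rcases le_total (2 * #X) #T with hle | hle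
  · obtain ⟨R, hRX, hR⟩ := exists_half_odd (G := G) X (T \ X.image p)
      fun t ht => hX t (mem_sdiff.1 ht).1
    set Q := (T \ X.image p).filter fun t => ∑ r ∈ R, adj G t r = 1 with hQ
    refine ⟨_, main R hRX Q (filter_subset _ _) fun q hq => (mem_filter.1 hq).2, ?_⟩
    have h1 : #(T \ X.image p) = #T - #X := by
      rw [card_sdiff_of_subset himg, card_image_of_injOn hinj]
    have h2 : #Q ≤ #((R ∪ Q ∪ (R.filter fun x => ∑ w ∈ R ∪ Q, adj G x w = 0).image p) ∩ T) := by
      refine card_le_card (subset_inter ?_ ((filter_subset _ _).trans sdiff_subset))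
      exact subset_union_right.trans subset_union_left
    omega
  -- If X is large, take R with even inner degrees and Q empty: every x ∈ R then needs p x, so p(R)
  -- ⊆ T is captured.
  · obtain ⟨R, hRX, hcard, hR⟩ := exists_large_even (adj G) (adj_comm G) X
    refine ⟨_, main R hRX ∅ (empty_subset _) (by simp), ?_⟩
    have h1 : (R.filter fun x => ∑ w ∈ R ∪ ∅, adj G x w = 0) = R := by
      rw [filter_eq_self]
      intro x hx
      rw [union_empty, hR x hx, adj_self]
    rw [h1]
    have h2 : #(R.image p) = #R := card_image_of_injOn (hinj.mono hRX)
    have h3 : #(R.image p) ≤ #((R ∪ ∅ ∪ R.image p) ∩ T) :=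
      card_le_card (subset_inter subset_union_right ((image_subset_image hRX).trans himg))
    omega

/-- In a graph without isolated vertices, every vertex set has an eighth of it in a set that spans
an induced subgraph with all degrees odd. -/
theorem exists_spansOdd_inter [DecidableEq V] (hG : ∀ v, ¬ G.IsIsolated v) (U : Finset V) :
    ∃ S : Finset V, SpansOdd G (S : Set V) ∧ #U ≤ 8 * #(S ∩ U) := by
  classical
  have hG' : ∀ v, ∃ w, G.Adj v w := by
    intro v
    by_contra! hv
    exact hG v (fun w => hv w)
  obtain ⟨I, hI⟩ := (Set.toFinite {I : Finset V | ∀ r ∈ I, ∀ s ∈ I, ¬ G.Adj r s}).exists_maximal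
    ⟨∅, by simp⟩
  have hind : ∀ r ∈ I, ∀ s ∈ I, ¬ G.Adj r s := hI.prop
  have hdom : ∀ t ∈ U \ I, ∃ x ∈ I, G.Adj t x := by
    intro t ht
    by_contra! h
    have htI := (mem_sdiff.1 ht).2
    refine htI (hI.le_of_ge (y := insert t I) ?_ (subset_insert _ _) (mem_insert_self _ _))
    intro r hr s hs
    rcases mem_insert.1 hr with rfl | hr
    · rcases mem_insert.1 hs with rfl | hs
      · exact G.loopless.irrefl _
      · exact h s hs
    · rcases mem_insert.1 hs with rfl | hs
      · exact fun ha => h r ‹_› ha.symm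
      · exact hind r hr s hs
  have hsplit := card_sdiff_add_card_inter U I
  -- The constant 8 is 2·2·2 in the first case and 2·4 in the second.
  rcases le_total #(U ∩ I) #(U \ I) with hle | hle
  · obtain ⟨R, hRI, hR⟩ := exists_half_odd I (U \ I) hdom
    obtain ⟨S, hS, hcard⟩ := exists_spansOdd_of_indep (G := G) (R := R)
      (T := (U \ I).filter fun t => ∑ r ∈ R, adj G t r = 1)
      (fun r hr s hs => hind r (hRI hr) s (hRI hs))
      (disjoint_left.2 fun r hr h => (mem_sdiff.1 (mem_filter.1 h).1).2 (hRI hr))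
      (fun t ht => (mem_filter.1 ht).2)
    refine ⟨S, hS, ?_⟩
    have : #(S ∩ (U \ I).filter fun t => ∑ r ∈ R, adj G t r = 1) ≤ #(S ∩ U) :=
      card_le_card (inter_subset_inter_left ((filter_subset _ _).trans sdiff_subset))
    omega
  · obtain ⟨S, hS, hcard⟩ := exists_spansOdd_inter_indep (G := G) (T := U ∩ I)
      (fun r hr s hs => hind r (mem_inter.1 hr).2 s (mem_inter.1 hs).2) (fun t _ => hG' t)
    refine ⟨S, hS, ?_⟩
    have : #(S ∩ (U ∩ I)) ≤ #(S ∩ U) := card_le_card (inter_subset_inter_left inter_subset_left)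
    omega

/-! ### Greedy covering -/

lemma exists_cover_of_card_lt [DecidableEq V] (hG : ∀ v, ¬ G.IsIsolated v) (k : ℕ)
    (U : Finset V) (hU : 7 ^ k * #U < 8 ^ k) :
    ∃ S : Fin k → Set V, (∀ i, SpansOdd G (S i)) ∧ (U : Set V) ⊆ ⋃ i, S i := by
  induction k generalizing U with
  | zero =>
    have : U = ∅ := by simpa using hU
    exact ⟨Fin.elim0, fun i => i.elim0, by simp [this]⟩
  | succ k ih =>
    obtain ⟨S, hS, hcard⟩ := exists_spansOdd_inter hG U
    have h1 := card_sdiff_add_card_inter U S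
    rw [inter_comm] at h1
    obtain ⟨F, hF, hcov⟩ := ih (U \ S) (by
      have h2 : 8 * #(U \ S) ≤ 7 * #U := by omega
      have h3 : 7 ^ k * (8 * #(U \ S)) ≤ 7 ^ k * (7 * #U) := Nat.mul_le_mul_left _ h2
      rw [pow_succ, pow_succ] at hU
      linarith)
    refine ⟨Fin.cons (S : Set V) F, fun i => ?_, fun v hv => ?_⟩
    · refine Fin.cases ?_ (fun j => ?_) i
      · simpa using hS
      · simpa using hF j
    · by_cases hvS : v ∈ S
      · exact Set.mem_iUnion.2 ⟨0, by simpa using hvS⟩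
      · obtain ⟨i, hi⟩ := Set.mem_iUnion.1 (hcov (mem_coe.2 (mem_sdiff.2 ⟨hv, hvS⟩)))
        exact Set.mem_iUnion.2 ⟨i.succ, by simpa using hi⟩

end

theorem maxCoverNumber_le_log (n : ℕ) : maxCoverNumber n ≤ 6 * (Nat.log 2 n + 1) := by
  rw [maxCoverNumber_le_iff]
  intro G hG
  -- Six rounds at least halve the uncovered set: 2·7⁶ ≤ 8⁶.
  obtain ⟨S, hS, hcov⟩ := exists_cover_of_card_lt hG (6 * (Nat.log 2 n + 1)) univ (by
    rw [card_univ, Fintype.card_fin, pow_mul, pow_mul]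
    have h1 : n < 2 ^ (Nat.log 2 n + 1) := Nat.lt_pow_succ_log_self one_lt_two n
    calc (7 ^ 6) ^ (Nat.log 2 n + 1) * n
        < (7 ^ 6) ^ (Nat.log 2 n + 1) * 2 ^ (Nat.log 2 n + 1) := by gcongr
      _ = (7 ^ 6 * 2) ^ (Nat.log 2 n + 1) := (mul_pow _ _ _).symm
      _ ≤ (8 ^ 6) ^ (Nat.log 2 n + 1) := Nat.pow_le_pow_left (by norm_num) _)
  exact ⟨S, hS, Set.eq_univ_of_univ_subset (by simpa using hcov)⟩

/-! ### Lower bound construction -/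

/-- The graph on `V` in which every vertex `w` outside the range of `a` is joined to `a i` and
`a j`, where `f w = (i, j)`. -/
def pairGraph {V ι : Type*} (a : ι → V) (f : V → ι × ι) : SimpleGraph V :=
  SimpleGraph.fromRel fun u w =>
    w ∉ Set.range a ∧ ∃ i, u = a i ∧ (i = (f w).1 ∨ i = (f w).2)

lemma pairGraph_adj_iff {V ι : Type*} {a : ι → V} {f : V → ι × ι} {w : V}
    (hw : w ∉ Set.range a) (v : V) :
    (pairGraph a f).Adj w v ↔ v = a (f w).1 ∨ v = a (f w).2 := by
  simp only [pairGraph, SimpleGraph.fromRel_adj]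
  constructor
  · rintro ⟨-, ⟨-, i, rfl, -⟩ | ⟨-, i, rfl, rfl | rfl⟩⟩
    · exact absurd ⟨i, rfl⟩ hw
    · exact Or.inl rfl
    · exact Or.inr rfl
  · rintro (rfl | rfl)
    · exact ⟨fun h => hw ⟨_, h.symm⟩, Or.inr ⟨hw, _, rfl, Or.inl rfl⟩⟩
    · exact ⟨fun h => hw ⟨_, h.symm⟩, Or.inr ⟨hw, _, rfl, Or.inr rfl⟩⟩

lemma card_le_two_pow_of_hasOddCover {V ι : Type*} [Fintype V] [Fintype ι] {a : ι → V}
    {f : V → ι × ι} (ha : Function.Injective a)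
    (hf : ∀ i j, ∃ w, w ∉ Set.range a ∧ f w = (i, j)) {k : ℕ}
    (h : HasOddCover (pairGraph a f) k) : Fintype.card ι ≤ 2 ^ k := by
  classical
  obtain ⟨S, hS, hcov⟩ := h
  have hinj : Function.Injective fun (i : ι) (t : Fin k) => decide (a i ∈ S t) := by
    intro i j hij
    by_contra hne
    obtain ⟨w, hw, hfw⟩ := hf i j
    obtain ⟨t, ht⟩ := Set.mem_iUnion.1 (hcov ▸ Set.mem_univ w : w ∈ ⋃ t, S t)
    have hiff : a i ∈ S t ↔ a j ∈ S t := by simpa using congrFun hij t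
    have hodd := hS t
    rw [← Set.coe_toFinset (S t), spansOdd_iff] at hodd
    have h1 := hodd w (by simpa using ht)
    have h2 : ∀ v, adj (pairGraph a f) w v
        = (if v = a i then 1 else 0) + (if v = a j then 1 else 0) := by
      intro v
      simp only [adj, pairGraph_adj_iff hw, hfw]
      by_cases h3 : v = a i
      · have h4 : ¬ v = a j := fun h => hne (ha (h3.symm.trans h))
        simp [h3, ha.ne hne]
      · simp [h3]
    -- Hubs i and j share their membership in S t, so w has 0 or 2 neighbours there.
    simp only [h2, sum_add_distrib, sum_ite_eq', Set.mem_toFinset, hiff] at h1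
    rw [CharTwo.add_self_eq_zero] at h1
    exact absurd h1 (by decide)
  simpa using Fintype.card_le_of_injective _ hinj

theorem le_two_pow_maxCoverNumber {m n : ℕ} (hm : 0 < m) (hmn : m + m * m ≤ n) :
    m ≤ 2 ^ maxCoverNumber n := by
  classical
  have : Nonempty (Fin m) := ⟨⟨0, hm⟩⟩
  obtain ⟨e⟩ : Nonempty (Fin m ⊕ (Fin m × Fin m) ↪ Fin n) :=
    Function.Embedding.nonempty_of_card_le (by simpa using hmn)
  let a : Fin m → Fin n := fun i => e (Sum.inl i)
  let b : Fin m × Fin m → Fin n := fun q => e (Sum.inr q)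
  -- By the default value, leftover vertices are joined to hub 0 and so are not isolated.
  let f : Fin n → Fin m × Fin m := Function.extend b id fun _ => (⟨0, hm⟩, ⟨0, hm⟩)
  have ha : Function.Injective a := e.injective.comp Sum.inl_injective
  have hb : Function.Injective b := e.injective.comp Sum.inr_injective
  have hba : ∀ q, b q ∉ Set.range a := by
    rintro q ⟨i, hi⟩
    exact Sum.inl_ne_inr (e.injective hi)
  have hf : ∀ q, f (b q) = q := fun q => hb.extend_apply _ _ _
  have hcov := (maxCoverNumber_le_iff n _).1 le_rfl (pairGraph a f) (by
    intro v hv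
    by_cases hva : v ∈ Set.range a
    · obtain ⟨i, rfl⟩ := hva
      exact hv (b (i, i)) ((pairGraph_adj_iff (hba (i, i)) _).2 (by simp [hf])).symm
    · exact hv _ ((pairGraph_adj_iff hva _).2 (Or.inl rfl)))
  simpa using card_le_two_pow_of_hasOddCover ha (fun i j => ⟨b (i, j), hba _, hf _⟩) hcov

theorem lt_four_pow_maxCoverNumber {n : ℕ} (hn : 9 ≤ n) : n < 4 ^ (3 * maxCoverNumber n) := by
  -- With m = ⌊√n⌋ − 1, m + m² ≤ (m + 1)² ≤ n.
  obtain ⟨m, hm⟩ : ∃ m, n.sqrt = m + 1 := ⟨n.sqrt - 1, by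
    have : 3 ≤ n.sqrt := Nat.le_sqrt.2 (by omega)
    omega⟩
  have h3 : 3 ≤ n.sqrt := Nat.le_sqrt.2 (by omega)
  have h1 : (m + 1) * (m + 1) ≤ n := hm ▸ Nat.sqrt_le n
  have h2 : n < (m + 2) * (m + 2) := by
    have := Nat.lt_succ_sqrt n
    rwa [hm] at this
  have hle := le_two_pow_maxCoverNumber (m := m) (n := n) (by omega) (by nlinarith)
  generalize maxCoverNumber n = k at hle ⊢
  -- n ≥ 9 gives m ≥ 2, hence m + 2 ≤ m³ and n < m⁶.
  have h4 : (m + 2) * (m + 2) ≤ (m * m * m) * (m * m * m) := by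
    have hm2 : 2 ≤ m := by omega
    have : m + 2 ≤ m * m * m := by nlinarith [Nat.mul_le_mul hm2 hm2]
    exact Nat.mul_le_mul this this
  calc n < (m * m * m) * (m * m * m) := h2.trans_le h4
    _ = (m * m) ^ 3 := by ring
    _ ≤ (2 ^ k * 2 ^ k) ^ 3 := by gcongr
    _ = 4 ^ (3 * k) := by rw [← mul_pow, ← pow_mul, mul_comm k 3]; norm_num

end OddCover

/-! ### Passage to real logarithms -/

theorem mainTheorem2 :
    (fun n : ℕ => (OddCover.maxCoverNumber n : ℝ)) =Θ[atTop] (fun n : ℕ => Real.log (n : ℝ)) := by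
  have hlog4 : 0 < Real.log 4 := Real.log_pos (by norm_num)
  have hlog2 : 0 < Real.log 2 := Real.log_pos (by norm_num)
  constructor
  -- For n ≥ 2, 6(log₂ n + 1) ≤ 12 log₂ n.
  · refine IsBigO.of_bound (12 / Real.log 2) ?_
    filter_upwards [eventually_ge_atTop 2] with n hn
    have hn' : (2 : ℝ) ≤ n := by exact_mod_cast hn
    have hpos : 0 ≤ Real.log n := Real.log_nonneg (by linarith)
    rw [Real.norm_of_nonneg (Nat.cast_nonneg _), Real.norm_of_nonneg hpos]
    have h1 : (OddCover.maxCoverNumber n : ℝ) ≤ 6 * (Nat.log 2 n + 1) := by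
      exact_mod_cast OddCover.maxCoverNumber_le_log n
    have h2 : (Nat.log 2 n : ℝ) * Real.log 2 ≤ Real.log n := by
      rw [← Real.log_pow]
      refine Real.log_le_log (by positivity) ?_
      exact_mod_cast Nat.pow_log_le_self 2 (by omega)
    have h3 : Real.log 2 ≤ Real.log n := Real.log_le_log (by norm_num) hn'
    rw [div_mul_eq_mul_div, le_div_iff₀ hlog2]
    nlinarith
  · refine IsBigO.of_bound (3 * Real.log 4) ?_
    filter_upwards [eventually_ge_atTop 9] with n hn
    have hn' : (9 : ℝ) ≤ n := by exact_mod_cast hn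
    have hpos : 0 ≤ Real.log n := Real.log_nonneg (by linarith)
    rw [Real.norm_of_nonneg (Nat.cast_nonneg _), Real.norm_of_nonneg hpos]
    have h1 : (n : ℝ) ≤ 4 ^ (3 * OddCover.maxCoverNumber n) := by
      exact_mod_cast (OddCover.lt_four_pow_maxCoverNumber hn).le
    have h2 := Real.log_le_log (by linarith) h1
    rw [Real.log_pow] at h2
    push_cast at h2
    linarith
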